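/- Let $G=\mathrm{PSL}(2,\mathbb{R})$ act by Möbius transformations on the upper half-plane $\mathbb{H}$, with hyperbolic distance $\operatorname{dist}$, and on its boundary $\partial_\infty\mathbb{H}=\mathbb{R}\cup\{\infty\}$. Let $\Gamma<G$ be a finitely generated, torsion-free, discrete subgroup. A point $\eta\in\partial_\infty\mathbb{H}$ is a parabolic fixed point (pfp) of $\Gamma$ if $\mathrm{Stab}_\Gamma(\eta)$ is conjugate in $G$ to $\pm\begin{pmatrix}1&\mathbb{Z}\\0&1\end{pmatrix}=\{\pm\begin{pmatrix}1&n\\0&1\end{pmatrix}:n\in\mathbb{Z}\}$. For a pfp $\eta$ let $$\mathcal{N}_\eta^{(\Gamma)}=\Big\{h\in G:\ h\cdot\eta=\infty,\ h\,\mathrm{Stab}_\Gamma(\eta)\,h^{-1}=\pm\begin{pmatrix}1&\mathbb{Z}\\0&1\end{pmatrix}\Big\},$$ and define the invariant height function on $\mathbb{H}$ by $$\mathcal{Y}_\Gamma(z)=\max\Big\{1,\ \sup\{\operatorname{Im}(h\cdot z):\ \eta\text{ a pfp of }\Gamma,\ h\in\mathcal{N}_\eta^{(\Gamma)}\}\Big\},$$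 so that $\mathcal{Y}_\Gamma\equiv 1$ if $\Gamma$ has no pfp. It is $\Gamma$-invariant, and we put $\mathcal{Y}_\Gamma(\Gamma g)=\mathcal{Y}_\Gamma(g\cdot i)$ for $\Gamma g\in\Gamma\backslash G$. For $\sigma>0$ define the horoballs $\mathcal{H}(\eta,\sigma)=\{z\in\mathbb{H}:|z-(\eta+i\sigma/2)|<\sigma/2\}$ for $\eta\in\mathbb{R}$ and $\mathcal{H}(\infty,\sigma)=\{z\in\mathbb{H}:\operatorname{Im} z>\sigma\}$. For $g,h\in G$ put $\mathsf{dist}_{\Gamma\backslash G}(\Gamma g,\Gamma h)=\inf_{\gamma\in\Gamma}\operatorname{dist}(\gamma g\cdot i,h\cdot i)$. Then the supremum defining $\mathcal{Y}_\Gamma(z)$ is finite for every $z\in\mathbb{H}$, and: (4) The set $\{z\in\mathbb{H}:\mathcal{Y}_\Gamma(z)>1\}$ is $\Gamma$-invariant and is a disjoint union of horoballs based at the pfps of $\Gamma$: for every pfp $\eta$ there is $\sigma_\eta>0$ such that the horoballs $\mathcal{H}(\eta,\sigma_\eta)$, with $\eta$ running over the pfps of $\Gamma$, are pairwise disjoint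 and their union is $\{z\in\mathbb{H}:\mathcal{Y}_\Gamma(z)>1\}$. (5) There exist constants $0<c_0<c_1$ such that $$c_0\,e^{\mathsf{dist}_{\Gamma\backslash G}(\Gamma g,\Gamma e)}\le\mathcal{Y}_\Gamma(\Gamma g)\le c_1\,e^{\mathsf{dist}_{\Gamma\backslash G}(\Gamma g,\Gamma e)}$$ for all $g\in G$ with $\mathcal{Y}_\Gamma(\Gamma g)>1$. -/

import Mathlib

open scoped MatrixGroups Topology

namespace HypSurf

/-- The group `G = PSL(2, ℝ)`, with the quotient topology from `SL(2, ℝ)`. -/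
abbrev G : Type := PSL(2, ℝ)

/-- Central elements of `SL(2, ℝ)` are `±1`. -/
theorem eq_one_or_neg_one_of_mem_center {s : SL(2, ℝ)} (hs : s ∈ Subgroup.center SL(2, ℝ)) :
    s = 1 ∨ s = -1 := by
  obtain ⟨r, hr, hrs⟩ := Matrix.SpecialLinearGroup.mem_center_iff.1 hs
  have hr' : (r - 1) * (r + 1) = 0 := by
    have : r ^ 2 = 1 := by simpa using hr
    linear_combination this
  rcases mul_eq_zero.1 hr' with h | h
  · left
    ext i j
    rw [← hrs, show r = 1 by linarith]
    simp
  · right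
    ext i j
    rw [← hrs, show r = -1 by linarith]
    fin_cases i <;> fin_cases j <;> simp

/-- The action of `PSL(2, ℝ)` on `ℍ` by Möbius transformations, induced by that of `SL(2, ℝ)`. -/
noncomputable def permUHP : G →* Equiv.Perm UpperHalfPlane :=
  QuotientGroup.lift _ (MulAction.toPermHom SL(2, ℝ) UpperHalfPlane) (by
    intro s hs
    ext z : 1
    change s • z = z
    rcases eq_one_or_neg_one_of_mem_center hs with rfl | rfl
    · exact one_smul _ z
    · have h1 : ((-1 : SL(2, ℝ)) : GL (Fin 2) ℝ) = -1 := by ext; simp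
      change ((-1 : SL(2, ℝ)) : GL (Fin 2) ℝ) • z = z
      rw [h1, UpperHalfPlane.neg_smul, one_smul])

noncomputable instance : MulAction G UpperHalfPlane := MulAction.compHom _ permUHP

theorem mk_smul (s : SL(2, ℝ)) (z : UpperHalfPlane) : (s : G) • z = s • z := rfl

instance : IsIsometricSMul G UpperHalfPlane where
  isometry_smul g := by
    induction g using QuotientGroup.induction_on with
    | H s => exact isometry_smul UpperHalfPlane s

/-- The action of `PSL(2, ℝ)` on `∂ℍ = ℝ ∪ {∞}` by Möbius transformations, induced by that of
`SL(2, ℝ) ≤ GL(2, ℝ)`. -/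
noncomputable def permBoundary : G →* Equiv.Perm (OnePoint ℝ) :=
  QuotientGroup.lift _
    ((MulAction.toPermHom (GL (Fin 2) ℝ) (OnePoint ℝ)).comp
      (Matrix.SpecialLinearGroup.toGL (n := Fin 2) (R := ℝ))) (by
    intro s hs
    ext x : 1
    change (Matrix.SpecialLinearGroup.toGL s) • x = x
    rcases eq_one_or_neg_one_of_mem_center hs with rfl | rfl
    · rw [map_one, one_smul]
    · induction x using OnePoint.rec with
      | infty => simp [OnePoint.smul_infty_eq_ite]
      | coe x => simp [OnePoint.smul_some_eq_ite])

noncomputable instance : MulAction G (OnePoint ℝ) := MulAction.compHom _ permBoundary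

theorem mk_smul_boundary (s : SL(2, ℝ)) (x : OnePoint ℝ) :
    (s : G) • x = (Matrix.SpecialLinearGroup.toGL s) • x := rfl

/-- The element `n_x = ±(1 x; 0 1)` of `G`. -/
noncomputable def unip (x : ℝ) : G :=
  QuotientGroup.mk (⟨!![1, x; 0, 1], by simp⟩ : SL(2, ℝ))

/-- `h Stab_Γ(η) h⁻¹ = ±(1 ℤ; 0 1)`. -/
def NormalizesStab (Γ : Subgroup G) (η : OnePoint ℝ) (h : G) : Prop :=
  (fun γ : G => h * γ * h⁻¹) '' {γ : G | γ ∈ Γ ∧ γ • η = η} = Set.range fun n : ℤ => unip n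

/-- `η` is a parabolic fixed point of `Γ`: its stabilizer in `Γ` is conjugate in `G` to
`±(1 ℤ; 0 1)`. -/
def IsPfp (Γ : Subgroup G) (η : OnePoint ℝ) : Prop :=
  ∃ h : G, NormalizesStab Γ η h

/-- The set `𝒩_η^{(Γ)}` of elements `h` of `G` such that `h η = ∞` and
`h Stab_Γ(η) h⁻¹ = ±(1 ℤ; 0 1)`. -/
def cuspNormalizers (Γ : Subgroup G) (η : OnePoint ℝ) : Set G :=
  {h | h • η = OnePoint.infty ∧ NormalizesStab Γ η h}

/-- The horoball based at `η` with parameter `σ`: for `η ∈ ℝ` the open Euclidean disc of diameter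
`σ` tangent to `ℝ` at `η`, for `η = ∞` the half-plane `Im z > σ`. -/
def horoball : OnePoint ℝ → ℝ → Set UpperHalfPlane
  | none, σ => {z | σ < z.im}
  | some x, σ => {z | ‖(z : ℂ) - ((x : ℂ) + Complex.I * (σ / 2 : ℝ))‖ < σ / 2}

/-- The numbers `Im (h_η z)`, where `η` runs over the parabolic fixed points of `Γ` and
`h_η ∈ 𝒩_η^{(Γ)}`. -/
def cuspHeights (Γ : Subgroup G) (z : UpperHalfPlane) : Set ℝ :=
  {t | ∃ η : OnePoint ℝ, IsPfp Γ η ∧ ∃ h ∈ cuspNormalizers Γ η, t = (h • z).im}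

/-- The invariant height function on `ℍ`: the maximum of `1` and the supremum of the heights
`Im (h_η z)` (if there are no parabolic fixed points, it is `1`). -/
noncomputable def invHeight (Γ : Subgroup G) (z : UpperHalfPlane) : ℝ :=
  max 1 (sSup (cuspHeights Γ z))

theorem cuspHeights_subset_smul {Γ : Subgroup G} {γ : G} (hγ : γ ∈ Γ) (z : UpperHalfPlane) :
    cuspHeights Γ (γ • z) ⊆ cuspHeights Γ z := by
  rintro t ⟨η, -, h, ⟨hη, hst⟩, rfl⟩
  have key : NormalizesStab Γ (γ⁻¹ • η) (h * γ) := by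
    unfold NormalizesStab
    rw [← hst]
    ext x
    constructor
    · rintro ⟨δ, ⟨hδ, hδη⟩, rfl⟩
      refine ⟨γ * δ * γ⁻¹, ⟨Γ.mul_mem (Γ.mul_mem hγ hδ) (Γ.inv_mem hγ), ?_⟩, by
        change h * (γ * δ * γ⁻¹) * h⁻¹ = h * γ * δ * (h * γ)⁻¹; group⟩
      rw [mul_smul, mul_smul, hδη, smul_inv_smul]
    · rintro ⟨δ, ⟨hδ, hδη⟩, rfl⟩
      refine ⟨γ⁻¹ * δ * γ, ⟨Γ.mul_mem (Γ.mul_mem (Γ.inv_mem hγ) hδ) hγ, ?_⟩, by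
        change h * γ * (γ⁻¹ * δ * γ) * (h * γ)⁻¹ = h * δ * h⁻¹; group⟩
      rw [mul_smul, mul_smul, smul_inv_smul, hδη]
  refine ⟨γ⁻¹ • η, ⟨_, key⟩, h * γ, ⟨?_, key⟩, by rw [mul_smul]⟩
  rw [mul_smul, smul_inv_smul, hη]

theorem invHeight_smul {Γ : Subgroup G} {γ : G} (hγ : γ ∈ Γ) (z : UpperHalfPlane) :
    invHeight Γ (γ • z) = invHeight Γ z := by
  unfold invHeight
  rw [(cuspHeights_subset_smul hγ z).antisymm]
  simpa using cuspHeights_subset_smul (Γ.inv_mem hγ) (γ • z)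

/-- The space `Γ \ G` of cosets `Γ g`. -/
abbrev CosetSpace (Γ : Subgroup G) : Type := Quotient (QuotientGroup.rightRel Γ)

/-- The coset `Γ g`. -/
abbrev coset (Γ : Subgroup G) (g : G) : CosetSpace Γ := Quotient.mk _ g

/-- The invariant height function on `Γ \ G`, `Γ g ↦ 𝒴_Γ(g · i)`. -/
noncomputable def cosetHeight (Γ : Subgroup G) : CosetSpace Γ → ℝ :=
  Quotient.lift (fun g : G => invHeight Γ (g • UpperHalfPlane.I)) (by
    intro a b hab
    have hab' : b * a⁻¹ ∈ Γ := QuotientGroup.rightRel_apply.1 hab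
    have := invHeight_smul hab' (a • UpperHalfPlane.I)
    rw [← mul_smul, inv_mul_cancel_right] at this
    exact this.symm)

/-- `dist_{Γ \ G}(Γ g, Γ h) = inf_{γ ∈ Γ} dist(γ g · i, h · i)`, with the hyperbolic distance. -/
noncomputable def cosetDist (Γ : Subgroup G) : CosetSpace Γ → CosetSpace Γ → ℝ :=
  Quotient.lift₂
    (fun g h : G => ⨅ γ : Γ, dist ((γ : G) • g • UpperHalfPlane.I) (h • UpperHalfPlane.I)) (by
    intro a b a' b' ha hb
    have ha' : a' * a⁻¹ ∈ Γ := QuotientGroup.rightRel_apply.1 ha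
    have hb' : b' * b⁻¹ ∈ Γ := QuotientGroup.rightRel_apply.1 hb
    let e : Γ ≃ Γ := (Equiv.mulRight (⟨_, ha'⟩ : Γ)⁻¹).trans (Equiv.mulLeft (⟨_, hb'⟩ : Γ))
    refine e.iInf_congr fun γ => ?_
    rw [← dist_smul (b' * b⁻¹) ((γ : G) • a • UpperHalfPlane.I) (b • UpperHalfPlane.I)]
    simp only [e, Equiv.trans_apply, Equiv.coe_mulRight, Equiv.coe_mulLeft, Subgroup.coe_mul,
      Subgroup.coe_inv, ← mul_smul]
    congr 2 <;> group)

end HypSurf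

open HypSurf

namespace HypSurf

/-! ### Möbius transformations sending a given boundary point to infinity -/

/-! For a fixed pfp the height `Im (h • z)` does not depend on the choice of normalizer
(`NormalizesStab.im_eq`), and Shimizu's lemma shows that at most one pfp sees a given point at
height above 1 (`NormalizesStab.im_lt_one`). This makes the supremum finite, and the set where the
height exceeds 1 is the disjoint union of the preimages of `{Im > 1}`, which are horoballs.

In (5), the upper bound holds because an isometry changes imaginary parts by at most the factor `exp
dist`, so the logarithm of the height is 1-Lipschitz. For the lower bound, a point high in a cusp is
translated by the stabilizer into a vertical strip, where its distance to a fixed point is the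
logarithm of its height up to a constant. The constant depends on the cusp, so finitely many orbits
of pfps are needed.

That finiteness is where finite generation enters. Fix a pfp `η₀`. For a pfp `η` of another orbit,
take a geodesic from `η₀` to `η` and the indicator `u` of one of its sides. Only finitely many
translates of a path cross the geodesic, so summing the increments of `u` along the translates of a
path from `z` to `g z` gives a homomorphism `Γ → ℤ`: the algebraic intersection number with the
geodesic in the quotient. It is `-1` on the parabolic generator at `η` and `0` on those of pfps
outside the orbits of `η₀` and `η`. A finitely generated group has only finitely many such
independent homomorphisms. -/

theorem mk_smul_infty_eq_infty_iff {g : SL(2, ℝ)} :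
    (g : G) • (OnePoint.infty : OnePoint ℝ) = OnePoint.infty ↔ g 1 0 = 0 := by
  rw [mk_smul_boundary, OnePoint.smul_infty_eq_self_iff]
  rfl

theorem mk_smul_coe_eq_infty_iff {g : SL(2, ℝ)} {x : ℝ} :
    (g : G) • (x : OnePoint ℝ) = OnePoint.infty ↔ g 1 0 * x + g 1 1 = 0 := by
  rw [mk_smul_boundary, OnePoint.smul_some_eq_ite]
  change (if g 1 0 * x + g 1 1 = 0 then _ else _) = _ ↔ _
  split_ifs with h <;> simp [h]

theorem sl_smul_im (g : SL(2, ℝ)) (w : UpperHalfPlane) :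
    (g • w).im = w.im / ((g 1 0 * w.re + g 1 1) ^ 2 + (g 1 0 * w.im) ^ 2) := by
  have hdet : g 0 0 * g 1 1 - g 0 1 * g 1 0 = 1 := by
    rw [← Matrix.det_fin_two]; exact g.det_coe
  have h := UpperHalfPlane.coe_specialLinearGroup_apply g w
  have := congrArg Complex.im h
  rw [UpperHalfPlane.coe_im] at this
  rw [this]
  simp only [Algebra.algebraMap_self, RingHom.id_apply, Complex.div_im, Complex.add_im,
    Complex.mul_im, Complex.ofReal_re, UpperHalfPlane.coe_im, Complex.ofReal_im,
    UpperHalfPlane.coe_re, zero_mul, add_zero, Complex.add_re, Complex.mul_re, sub_zero,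
    Complex.normSq_apply]
  rw [← sub_div]
  congr 1
  · linear_combination w.im * hdet
  · ring

theorem sl_smul_re (g : SL(2, ℝ)) (w : UpperHalfPlane) :
    (g • w).re = ((g 0 0 * w.re + g 0 1) * (g 1 0 * w.re + g 1 1) + g 0 0 * g 1 0 * w.im ^ 2) /
      ((g 1 0 * w.re + g 1 1) ^ 2 + (g 1 0 * w.im) ^ 2) := by
  have h := UpperHalfPlane.coe_specialLinearGroup_apply g w
  have := congrArg Complex.re h
  rw [UpperHalfPlane.coe_re] at this
  rw [this]
  simp only [Algebra.algebraMap_self, RingHom.id_apply, Complex.div_re, Complex.add_im,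
    Complex.mul_im, Complex.ofReal_re, UpperHalfPlane.coe_im, Complex.ofReal_im,
    UpperHalfPlane.coe_re, zero_mul, add_zero, Complex.add_re, Complex.mul_re, sub_zero,
    Complex.normSq_apply]
  rw [← add_div]
  congr 1 <;> ring

theorem exists_affine_of_smul_infty {g : G}
    (hg : g • (OnePoint.infty : OnePoint ℝ) = OnePoint.infty) :
    ∃ k b : ℝ, 0 < k ∧ ∀ w : UpperHalfPlane, (g • w).im = k * w.im ∧ (g • w).re = k * w.re + b := by
  induction g using QuotientGroup.induction_on with
  | H g =>
    rw [mk_smul_infty_eq_infty_iff] at hg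
    have hdet : g 0 0 * g 1 1 - g 0 1 * g 1 0 = 1 := by
      rw [← Matrix.det_fin_two]; exact g.det_coe
    rw [hg, mul_zero, sub_zero] at hdet
    have hd : g 1 1 ≠ 0 := right_ne_zero_of_mul (hdet ▸ one_ne_zero)
    refine ⟨1 / g 1 1 ^ 2, g 0 1 / g 1 1, by positivity, fun w => ?_⟩
    rw [mk_smul, sl_smul_im, sl_smul_re, hg]
    constructor
    · field_simp; ring
    · have ha : g 0 0 = 1 / g 1 1 := by rw [eq_div_iff hd, hdet]
      rw [ha]
      field_simp
      ring

theorem exists_inversion_of_smul_coe {g : G} {x : ℝ} (hg : g • (x : OnePoint ℝ) = OnePoint.infty) :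
    ∃ k a : ℝ, 0 < k ∧ ∀ w : UpperHalfPlane,
      (g • w).im = w.im / (k * ((w.re - x) ^ 2 + w.im ^ 2)) ∧
      (g • w).re = a - (w.re - x) / (k * ((w.re - x) ^ 2 + w.im ^ 2)) := by
  induction g using QuotientGroup.induction_on with
  | H g =>
    rw [mk_smul_coe_eq_infty_iff] at hg
    have hdet : g 0 0 * g 1 1 - g 0 1 * g 1 0 = 1 := by
      rw [← Matrix.det_fin_two]; exact g.det_coe
    have hd : g 1 1 = - (g 1 0 * x) := by linarith
    have hc : g 1 0 ≠ 0 := by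
      intro h
      rw [hd, h] at hdet
      simp at hdet
    refine ⟨g 1 0 ^ 2, g 0 0 / g 1 0, by positivity, fun w => ?_⟩
    have hb : g 0 1 = -(1 + g 0 0 * (g 1 0 * x)) / g 1 0 := by
      rw [hd] at hdet
      field_simp; linarith
    have hp : 0 < (w.re - x) ^ 2 + w.im ^ 2 := by have := w.im_pos; positivity
    have he : (g 1 0 * w.re + g 1 1) ^ 2 + (g 1 0 * w.im) ^ 2 =
        g 1 0 ^ 2 * ((w.re - x) ^ 2 + w.im ^ 2) := by rw [hd]; ring
    rw [mk_smul, sl_smul_im, sl_smul_re, he]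
    refine ⟨rfl, ?_⟩
    rw [hb, hd]
    field_simp
    ring

/-- The matrix `(1 x; 0 1)` of `SL(2, ℝ)`. -/
noncomputable def unipSL (x : ℝ) : SL(2, ℝ) := ⟨!![1, x; 0, 1], by simp⟩

theorem unip_eq (x : ℝ) : unip x = (unipSL x : G) := rfl

@[simp] theorem unipSL_zero_zero (x : ℝ) : unipSL x 0 0 = 1 := rfl

@[simp] theorem unipSL_zero_one (x : ℝ) : unipSL x 0 1 = x := rfl

@[simp] theorem unipSL_one_zero (x : ℝ) : unipSL x 1 0 = 0 := rfl

@[simp] theorem unipSL_one_one (x : ℝ) : unipSL x 1 1 = 1 := rfl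

theorem unip_smul_im (x : ℝ) (w : UpperHalfPlane) : (unip x • w).im = w.im := by
  rw [unip_eq, mk_smul, sl_smul_im]; simp

theorem unip_smul_re (x : ℝ) (w : UpperHalfPlane) : (unip x • w).re = w.re + x := by
  rw [unip_eq, mk_smul, sl_smul_re]; simp

theorem unip_smul_infty (x : ℝ) : unip x • (OnePoint.infty : OnePoint ℝ) = OnePoint.infty := by
  rw [unip_eq, mk_smul_infty_eq_infty_iff]; rfl

theorem unip_add (x y : ℝ) : unip (x + y) = unip x * unip y := by
  rw [unip_eq, unip_eq, unip_eq, ← QuotientGroup.mk_mul]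
  congr 1
  ext i j
  fin_cases i <;> fin_cases j <;> simp [Matrix.mul_apply, Fin.sum_univ_two, add_comm]

theorem unip_zero : unip 0 = 1 := by
  have := unip_add 0 0
  rw [add_zero] at this
  exact left_eq_mul.1 this

theorem unip_fixes_infty {x : OnePoint ℝ} (hx : unip 1 • x = x) : x = OnePoint.infty := by
  induction x using OnePoint.rec with
  | infty => rfl
  | coe x =>
    rw [unip_eq, mk_smul_boundary, OnePoint.smul_some_eq_ite] at hx
    change (if unipSL 1 1 0 * x + unipSL 1 1 1 = 0 then _ else
      (((unipSL 1 0 0 * x + unipSL 1 0 1) / (unipSL 1 1 0 * x + unipSL 1 1 1) : ℝ) :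
        OnePoint ℝ)) = _ at hx
    simp at hx

/-- An element sending `η` to `∞` maps some horoball based at `η` onto `{Im > 1}`. -/
theorem exists_horoball_eq {g : G} {η : OnePoint ℝ} (hg : g • η = OnePoint.infty) :
    ∃ σ : ℝ, 0 < σ ∧ horoball η σ = {z | 1 < (g • z).im} := by
  induction η using OnePoint.rec with
  | infty =>
    obtain ⟨k, b, hk, h⟩ := exists_affine_of_smul_infty hg
    refine ⟨1 / k, by positivity, ?_⟩
    ext z
    change 1 / k < z.im ↔ 1 < (g • z).im
    rw [(h z).1, div_lt_iff₀' hk]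
  | coe x =>
    obtain ⟨k, a, hk, h⟩ := exists_inversion_of_smul_coe hg
    refine ⟨1 / k, by positivity, ?_⟩
    ext z
    change ‖(z : ℂ) - ((x : ℂ) + Complex.I * ((1 / k) / 2 : ℝ))‖ < (1 / k) / 2 ↔ 1 < (g • z).im
    have hp : 0 < (z.re - x) ^ 2 + z.im ^ 2 := by have := z.im_pos; positivity
    rw [(h z).1, lt_div_iff₀ (by positivity : 0 < k * ((z.re - x) ^ 2 + z.im ^ 2)), one_mul,
      ← sq_lt_sq₀ (norm_nonneg _) (by positivity), ← Complex.normSq_eq_norm_sq,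
      Complex.normSq_apply]
    simp only [Complex.sub_re, UpperHalfPlane.coe_re, Complex.add_re, Complex.ofReal_re,
      Complex.mul_re, Complex.I_re, zero_mul, Complex.I_im, Complex.ofReal_im, mul_zero, sub_zero,
      add_zero, Complex.sub_im, UpperHalfPlane.coe_im, Complex.add_im, Complex.mul_im, one_mul,
      zero_add]
    have : (z.re - x) * (z.re - x) + (z.im - 1 / k / 2) * (z.im - 1 / k / 2) - (1 / k / 2) ^ 2 =
        (k * ((z.re - x) ^ 2 + z.im ^ 2) - z.im) / k := by
      field_simp; ring
    rw [← sub_neg, this, div_neg_iff]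
    constructor
    · rintro (h | h)
      · linarith [h.2]
      · linarith [h.1]
    · intro h
      exact Or.inr ⟨by linarith, hk⟩

/-! ### Discreteness -/

instance : T2Space G := by
  have : IsClosed ((Subgroup.center SL(2, ℝ) : Subgroup SL(2, ℝ)) : Set SL(2, ℝ)) := by
    rw [← Subgroup.centralizer_univ]
    exact Set.isClosed_centralizer _
  infer_instance

/-- A discrete subgroup of `G` acts properly discontinuously on `ℍ`. -/
theorem finite_dist_le {Γ : Subgroup G} (hdisc : DiscreteTopology Γ) (z w : UpperHalfPlane)
    (R : ℝ) : {γ : G | γ ∈ Γ ∧ dist (γ • z) w ≤ R}.Finite := by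
  -- The radius bounds `dist (g • I) I` along `g • I`, `g • z`, `w`, `I`. Properness of the orbit
  -- map makes `K` compact, and a compact set meets a closed discrete subgroup in a finite set.
  set K : Set SL(2, ℝ) := (fun g : SL(2, ℝ) => g • UpperHalfPlane.I) ⁻¹'
    Metric.closedBall UpperHalfPlane.I (dist UpperHalfPlane.I z + R + dist w UpperHalfPlane.I)
  have hK : IsCompact K := UpperHalfPlane.isProperMap_smul_I.isCompact_preimage
    (isCompact_closedBall _ _)
  have hK' : IsCompact ((fun g : SL(2, ℝ) => (g : G)) '' K) :=
    hK.image QuotientGroup.continuous_mk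
  have hcl : IsClosed (Γ : Set G) := Subgroup.isClosed_of_discrete
  have hfin : ((fun g : SL(2, ℝ) => (g : G)) '' K ∩ (Γ : Set G)).Finite :=
    (hK'.inter_right hcl).finite ⟨DiscreteTopology.of_subset hdisc Set.inter_subset_right⟩
  refine hfin.subset ?_
  rintro γ ⟨hγ, hd⟩
  refine ⟨?_, hγ⟩
  obtain ⟨g, rfl⟩ := QuotientGroup.mk_surjective γ
  refine ⟨g, ?_, rfl⟩
  change dist (g • UpperHalfPlane.I) UpperHalfPlane.I ≤ _
  rw [mk_smul] at hd
  have h1 := dist_triangle4 (g • UpperHalfPlane.I) (g • z) w UpperHalfPlane.I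
  rw [dist_smul] at h1
  linarith

/-! ### Normalizing elements -/

/-- The conjugated stabilizer contains `unip 1`, whose only boundary fixed point is `∞`. Hence the
first condition in `cuspNormalizers` follows from the second. -/
theorem NormalizesStab.smul_eq_infty {Γ : Subgroup G} {η : OnePoint ℝ} {h : G}
    (hh : NormalizesStab Γ η h) : h • η = OnePoint.infty := by
  have h1 : unip (1 : ℤ) ∈ Set.range fun n : ℤ => unip n := ⟨1, rfl⟩
  rw [← show _ = _ from hh] at h1
  obtain ⟨γ, ⟨-, hγ⟩, he⟩ := h1
  apply unip_fixes_infty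
  rw [← Int.cast_one, ← he]
  change (h * γ * h⁻¹) • h • η = _
  rw [mul_smul, inv_smul_smul, mul_smul, hγ]

theorem NormalizesStab.conj_unip_mem {Γ : Subgroup G} {η : OnePoint ℝ} {h : G}
    (hh : NormalizesStab Γ η h) (n : ℤ) : h⁻¹ * unip n * h ∈ Γ := by
  have h1 : unip n ∈ Set.range fun n : ℤ => unip n := ⟨n, rfl⟩
  rw [← show _ = _ from hh] at h1
  obtain ⟨γ, ⟨hΓ, -⟩, he⟩ := h1
  rw [← he]
  convert hΓ using 1
  group

theorem NormalizesStab.exists_unip {Γ : Subgroup G} {η : OnePoint ℝ} {h γ : G}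
    (hh : NormalizesStab Γ η h) (hγ : γ ∈ Γ) (hη : γ • η = η) :
    ∃ n : ℤ, h * γ * h⁻¹ = unip n := by
  have h1 : h * γ * h⁻¹ ∈ (fun γ : G => h * γ * h⁻¹) '' {γ : G | γ ∈ Γ ∧ γ • η = η} :=
    ⟨γ, ⟨hγ, hη⟩, rfl⟩
  rw [show _ = _ from hh] at h1
  obtain ⟨n, hn⟩ := h1
  exact ⟨n, hn.symm⟩

theorem NormalizesStab.translate {Γ : Subgroup G} {η : OnePoint ℝ} {h γ : G}
    (hh : NormalizesStab Γ η h) (hγ : γ ∈ Γ) : NormalizesStab Γ (γ • η) (h * γ⁻¹) := by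
  unfold NormalizesStab
  rw [← show _ = _ from hh]
  ext x
  constructor
  · rintro ⟨δ, ⟨hδ, hδη⟩, rfl⟩
    refine ⟨γ⁻¹ * δ * γ, ⟨Γ.mul_mem (Γ.mul_mem (Γ.inv_mem hγ) hδ) hγ, ?_⟩, ?_⟩
    · rw [mul_smul, mul_smul, hδη, inv_smul_smul]
    · change h * (γ⁻¹ * δ * γ) * h⁻¹ = h * γ⁻¹ * δ * (h * γ⁻¹)⁻¹
      group
  · rintro ⟨δ, ⟨hδ, hδη⟩, rfl⟩
    refine ⟨γ * δ * γ⁻¹, ⟨Γ.mul_mem (Γ.mul_mem hγ hδ) (Γ.inv_mem hγ), ?_⟩, ?_⟩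
    · rw [mul_smul, mul_smul, inv_smul_smul, hδη]
    · change h * γ⁻¹ * (γ * δ * γ⁻¹) * (h * γ⁻¹)⁻¹ = h * δ * h⁻¹
      group

/-- The element `h' * h⁻¹` fixes `∞`, so it acts as `w ↦ k w + b` and conjugates translation by 1 to
translation by `k`. Since `h'` is also normalizing, `k` is a positive integer. Exchanging `h` and
`h'` then gives equality. -/
theorem NormalizesStab.im_le {Γ : Subgroup G} {η : OnePoint ℝ} {h h' : G}
    (hh : NormalizesStab Γ η h) (hh' : NormalizesStab Γ η h') (z : UpperHalfPlane) :
    (h • z).im ≤ (h' • z).im := by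
  have hinf : (h' * h⁻¹) • (OnePoint.infty : OnePoint ℝ) = OnePoint.infty := by
    rw [mul_smul, ← hh.smul_eq_infty, inv_smul_smul, hh'.smul_eq_infty, hh.smul_eq_infty]
  obtain ⟨k, b, hk, hkb⟩ := exists_affine_of_smul_infty hinf
  have hη : (h⁻¹ * unip (1 : ℤ) * h) • η = η := by
    rw [mul_smul, mul_smul, hh.smul_eq_infty, unip_smul_infty, inv_smul_eq_iff, hh.smul_eq_infty]
  obtain ⟨n, hn⟩ := hh'.exists_unip (hh.conj_unip_mem 1) hη
  have hcomm : (h' * h⁻¹) * unip (1 : ℤ) = unip n * (h' * h⁻¹) := by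
    rw [← hn]; group
  have hkn : k = n := by
    have := congrArg (fun g : G => (g • z).re) hcomm
    simp only [mul_smul] at this
    rw [← mul_smul, ← mul_smul h', (hkb _).2, unip_smul_re, unip_smul_re, (hkb _).2] at this
    push_cast at this
    linarith
  have h1 : (1 : ℝ) ≤ k := by
    rw [hkn] at hk ⊢
    exact_mod_cast Int.cast_pos.1 hk
  have := (hkb (h • z)).1
  rw [← mul_smul, inv_mul_cancel_right] at this
  rw [this]
  exact le_mul_of_one_le_left (h • z).im_pos.le h1

theorem NormalizesStab.im_eq {Γ : Subgroup G} {η : OnePoint ℝ} {h h' : G}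
    (hh : NormalizesStab Γ η h) (hh' : NormalizesStab Γ η h') (z : UpperHalfPlane) :
    (h • z).im = (h' • z).im :=
  (hh.im_le hh' z).antisymm (hh'.im_le hh z)

/-! ### Shimizu's lemma -/

theorem sl_inv_apply (A : SL(2, ℝ)) :
    A⁻¹ 0 0 = A 1 1 ∧ A⁻¹ 0 1 = -A 0 1 ∧ A⁻¹ 1 0 = -A 1 0 ∧ A⁻¹ 1 1 = A 0 0 := by
  rw [Matrix.SpecialLinearGroup.SL2_inv_expl]
  exact ⟨rfl, rfl, rfl, rfl⟩

theorem conj_unipSL_one (A : SL(2, ℝ)) :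
    (A * unipSL 1 * A⁻¹) 0 0 = 1 - A 0 0 * A 1 0 ∧ (A * unipSL 1 * A⁻¹) 0 1 = A 0 0 ^ 2 ∧
    (A * unipSL 1 * A⁻¹) 1 0 = -A 1 0 ^ 2 ∧ (A * unipSL 1 * A⁻¹) 1 1 = 1 + A 0 0 * A 1 0 := by
  have hdet : A 0 0 * A 1 1 - A 0 1 * A 1 0 = 1 := by
    rw [← Matrix.det_fin_two]; exact A.det_coe
  obtain ⟨h00, h01, h10, h11⟩ := sl_inv_apply A
  simp only [Matrix.SpecialLinearGroup.coe_mul, Matrix.mul_apply, Fin.sum_univ_two,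
    unipSL_zero_zero, unipSL_zero_one, unipSL_one_zero, unipSL_one_one, h00, h01, h10, h11]
  refine ⟨?_, ?_, ?_, ?_⟩
  · linear_combination hdet
  · ring
  · ring
  · linear_combination hdet

/-- The iterates of `B ↦ B (1 1; 0 1) B⁻¹`. -/
noncomputable def shimizuSeq (B : SL(2, ℝ)) : ℕ → SL(2, ℝ)
  | 0 => B
  | n + 1 => shimizuSeq B n * unipSL 1 * (shimizuSeq B n)⁻¹

theorem shimizuSeq_one_zero_ne {B : SL(2, ℝ)} (hB : B 1 0 ≠ 0) (n : ℕ) :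
    shimizuSeq B n 1 0 ≠ 0 := by
  induction n with
  | zero => exact hB
  | succ n ih =>
    rw [shimizuSeq, (conj_unipSL_one _).2.2.1]
    simpa using ih

/-- With first column `(a, c)`, one step is `c ↦ -c²`, `a ↦ 1 - a c`. So `c` tends to 0, `a` stays
bounded, and therefore `a c → 0`; the limits of all entries follow. -/
theorem tendsto_shimizuSeq {B : SL(2, ℝ)} (hB : |B 1 0| < 1) :
    Filter.Tendsto (shimizuSeq B) Filter.atTop (𝓝 (unipSL 1)) := by
  set c := |B 1 0|
  have hc0 : 0 ≤ c := abs_nonneg _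
  have hc : ∀ n, |shimizuSeq B n 1 0| ≤ c ^ (n + 1) := by
    intro n
    induction n with
    | zero => simp [shimizuSeq, c]
    | succ n ih =>
      rw [shimizuSeq, (conj_unipSL_one _).2.2.1, abs_neg, abs_pow, sq, pow_succ]
      refine mul_le_mul ih (ih.trans ?_) (abs_nonneg _) (by positivity)
      exact pow_le_of_le_one hc0 hB.le (by omega)
  have hc1 : ∀ n, |shimizuSeq B n 1 0| ≤ c := fun n =>
    (hc n).trans (pow_le_of_le_one hc0 hB.le (by omega))
  -- The bound `M ≥ 1 / (1 - c)` says that `|a| ≤ M` is preserved by `a ↦ 1 - a c`.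
  set M := max |B 0 0| (1 / (1 - c))
  have hM : 1 + M * c ≤ M := by
    have h1 : 1 / (1 - c) ≤ M := le_max_right _ _
    rw [div_le_iff₀ (by linarith)] at h1
    linarith
  have ha : ∀ n, |shimizuSeq B n 0 0| ≤ M := by
    intro n
    induction n with
    | zero => exact le_max_left _ _
    | succ n ih =>
      rw [shimizuSeq, (conj_unipSL_one _).1]
      refine (abs_sub _ _).trans (le_trans ?_ hM)
      rw [abs_one, abs_mul]
      gcongr
      exact hc1 n
  have hlim : Filter.Tendsto (fun n => shimizuSeq B n 1 0) Filter.atTop (𝓝 0) := by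
    refine squeeze_zero_norm hc ?_
    exact (tendsto_pow_atTop_nhds_zero_of_lt_one hc0 hB).comp (Filter.tendsto_add_atTop_nat 1)
  have hmul : Filter.Tendsto (fun n => shimizuSeq B n 0 0 * shimizuSeq B n 1 0) Filter.atTop
      (𝓝 0) := by
    refine squeeze_zero_norm (a := fun n => M * c ^ (n + 1)) (fun n => ?_) ?_
    · rw [norm_mul]
      exact mul_le_mul (ha n) (hc n) (norm_nonneg _) ((abs_nonneg _).trans (ha n))
    · rw [← mul_zero M]
      exact ((tendsto_pow_atTop_nhds_zero_of_lt_one hc0 hB).comp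
        (Filter.tendsto_add_atTop_nat 1)).const_mul M
  have h00 : Filter.Tendsto (fun n => shimizuSeq B (n + 1) 0 0) Filter.atTop (𝓝 1) := by
    simp only [shimizuSeq, (conj_unipSL_one _).1]
    simpa using hmul.const_sub 1
  have h00' := (Filter.tendsto_add_atTop_iff_nat (f := fun n => shimizuSeq B n 0 0) 1).1 h00
  have h01 : Filter.Tendsto (fun n => shimizuSeq B (n + 1) 0 1) Filter.atTop (𝓝 1) := by
    simp only [shimizuSeq, (conj_unipSL_one _).2.1]
    simpa using h00'.pow 2
  have h11 : Filter.Tendsto (fun n => shimizuSeq B (n + 1) 1 1) Filter.atTop (𝓝 1) := by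
    simp only [shimizuSeq, (conj_unipSL_one _).2.2.2]
    simpa using hmul.const_add 1
  have h01' := (Filter.tendsto_add_atTop_iff_nat (f := fun n => shimizuSeq B n 0 1) 1).1 h01
  have h11' := (Filter.tendsto_add_atTop_iff_nat (f := fun n => shimizuSeq B n 1 1) 1).1 h11
  refine tendsto_subtype_rng.2 (tendsto_pi_nhds.2 fun i => tendsto_pi_nhds.2 fun j => ?_)
  fin_cases i <;> fin_cases j
  · exact h00'
  · exact h01'
  · exact hlim
  · exact h11'

/-- Otherwise the iterates, conjugated into `Γ`, converge to the parabolic generator. By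
discreteness some iterate equals it, yet no iterate has vanishing lower left entry. -/
theorem one_le_abs_of_conj_mem {Γ : Subgroup G} (hdisc : DiscreteTopology Γ) {h : G}
    (hT : h⁻¹ * unip 1 * h ∈ Γ) {B : SL(2, ℝ)} (hB : h⁻¹ * (B : G) * h ∈ Γ) (hc : B 1 0 ≠ 0) :
    1 ≤ |B 1 0| := by
  by_contra! hlt
  have hmem : ∀ n, h⁻¹ * (shimizuSeq B n : G) * h ∈ Γ := by
    intro n
    induction n with
    | zero => exact hB
    | succ n ih =>
      have := Γ.mul_mem (Γ.mul_mem ih hT) (Γ.inv_mem ih)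
      rw [shimizuSeq, QuotientGroup.mk_mul, QuotientGroup.mk_mul, QuotientGroup.mk_inv, ← unip_eq]
      convert this using 1
      group
  let x : ℕ → Γ := fun n =>
    ⟨h⁻¹ * (shimizuSeq B n : G) * h, hmem n⟩
  have hx : Filter.Tendsto x Filter.atTop (𝓝 ⟨h⁻¹ * unip 1 * h, hT⟩) := by
    rw [tendsto_subtype_rng]
    have h1 : Filter.Tendsto (fun n => (shimizuSeq B n : G)) Filter.atTop (𝓝 (unip 1)) :=
      (QuotientGroup.continuous_mk.tendsto _).comp (tendsto_shimizuSeq hlt)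
    exact (h1.const_mul h⁻¹).mul_const h
  rw [nhds_discrete, Filter.tendsto_pure] at hx
  obtain ⟨n, hn⟩ := hx.exists
  have he : (shimizuSeq B n : G) = unip 1 := by
    have := congrArg Subtype.val hn
    simpa [x] using this
  have hz : (shimizuSeq B n : G) • (OnePoint.infty : OnePoint ℝ) = OnePoint.infty := by
    rw [he, unip_smul_infty]
  exact shimizuSeq_one_zero_ne hc n (mk_smul_infty_eq_infty_iff.1 hz)

/-- The horoballs of height `1` at distinct parabolic fixed points are disjoint. -/
theorem NormalizesStab.im_lt_one {Γ : Subgroup G} (hdisc : DiscreteTopology Γ)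
    {η₁ η₂ : OnePoint ℝ} {h₁ h₂ : G} (hh₁ : NormalizesStab Γ η₁ h₁) (hh₂ : NormalizesStab Γ η₂ h₂)
    (hne : η₁ ≠ η₂) {z : UpperHalfPlane} (hz : 1 < (h₁ • z).im) : (h₂ • z).im < 1 := by
  obtain ⟨g, hg⟩ := QuotientGroup.mk_surjective (h₂ * h₁⁻¹)
  have hc : g 1 0 ≠ 0 := by
    intro h0
    have h1 := mk_smul_infty_eq_infty_iff.2 h0
    rw [hg] at h1
    nth_rw 1 [← hh₁.smul_eq_infty] at h1
    rw [mul_smul, inv_smul_smul, ← hh₂.smul_eq_infty] at h1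
    exact hne (MulAction.injective h₂ h1)
  -- In the coordinate `h₁`, the parabolic generator at `η₂` is `g⁻¹ (1 1; 0 1) g`, with lower left
  -- entry `-c²` for `c = g 1 0`. Shimizu's lemma gives `c² ≥ 1`, whence `Im (g w) ≤ 1 / Im w < 1`.
  have hB : h₁⁻¹ * ((g⁻¹ * unipSL 1 * g⁻¹⁻¹ : SL(2, ℝ)) : G) * h₁ ∈ Γ := by
    rw [inv_inv, QuotientGroup.mk_mul, QuotientGroup.mk_mul, QuotientGroup.mk_inv, hg, ← unip_eq]
    have := hh₂.conj_unip_mem 1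
    rw [Int.cast_one] at this
    convert this using 1
    group
  have hT := hh₁.conj_unip_mem 1
  rw [Int.cast_one] at hT
  have he : (g⁻¹ * unipSL 1 * g⁻¹⁻¹) 1 0 = -g 1 0 ^ 2 := by
    rw [(conj_unipSL_one g⁻¹).2.2.1, (sl_inv_apply g).2.2.1, neg_sq]
  have h1 := one_le_abs_of_conj_mem hdisc hT hB (by rw [he]; simpa using hc)
  rw [he, abs_neg, abs_pow, sq_abs] at h1
  have h2 : h₂ • z = g • (h₁ • z) := by
    rw [← mk_smul, hg, ← mul_smul, inv_mul_cancel_right]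
  rw [h2, sl_smul_im]
  set w := h₁ • z
  have hw := w.im_pos
  have h3 : w.im ^ 2 ≤ (g 1 0 * w.re + g 1 1) ^ 2 + (g 1 0 * w.im) ^ 2 := by
    have := mul_le_mul_of_nonneg_right h1 (sq_nonneg w.im)
    nlinarith [sq_nonneg (g 1 0 * w.re + g 1 1)]
  rw [div_lt_one (lt_of_lt_of_le (by positivity) h3)]
  nlinarith

/-! ### The height function -/

theorem bddAbove_cuspHeights {Γ : Subgroup G} (hdisc : DiscreteTopology Γ) (z : UpperHalfPlane) :
    BddAbove (cuspHeights Γ z) := by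
  by_cases H : ∃ η h, NormalizesStab Γ η h ∧ 1 < (h • z).im
  · obtain ⟨η, h, hh, hz⟩ := H
    refine ⟨(h • z).im, ?_⟩
    rintro t ⟨η', -, h', ⟨-, hh'⟩, rfl⟩
    by_cases he : η = η'
    · subst he
      exact hh'.im_le hh z
    · exact ((hh.im_lt_one hdisc hh' he hz).trans hz).le
  · refine ⟨1, ?_⟩
    rintro t ⟨η', -, h', ⟨-, hh'⟩, rfl⟩
    by_contra! hlt
    exact H ⟨η', h', hh', hlt⟩

theorem one_le_invHeight (Γ : Subgroup G) (z : UpperHalfPlane) : 1 ≤ invHeight Γ z :=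
  le_max_left _ _

theorem NormalizesStab.im_le_invHeight {Γ : Subgroup G} (hdisc : DiscreteTopology Γ)
    {η : OnePoint ℝ} {h : G} (hh : NormalizesStab Γ η h) (z : UpperHalfPlane) :
    (h • z).im ≤ invHeight Γ z :=
  (le_csSup (bddAbove_cuspHeights hdisc z)
    ⟨η, ⟨h, hh⟩, h, ⟨hh.smul_eq_infty, hh⟩, rfl⟩).trans (le_max_right _ _)

theorem one_lt_invHeight_iff {Γ : Subgroup G} (hdisc : DiscreteTopology Γ) {z : UpperHalfPlane} :
    1 < invHeight Γ z ↔ ∃ η h, NormalizesStab Γ η h ∧ 1 < (h • z).im := by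
  constructor
  · intro hz
    rw [invHeight, lt_max_iff] at hz
    have h1 := hz.resolve_left (lt_irrefl _)
    -- The real supremum of the empty set is 0, so a supremum above 1 forces nonemptiness.
    have hne : (cuspHeights Γ z).Nonempty := by
      by_contra hne
      rw [Set.not_nonempty_iff_eq_empty.1 hne, Real.sSup_empty] at h1
      linarith
    obtain ⟨t, ⟨η, -, h, ⟨-, hh⟩, rfl⟩, ht⟩ := exists_lt_of_lt_csSup hne h1
    exact ⟨η, h, hh, ht⟩
  · rintro ⟨η, h, hh, hz⟩
    exact hz.trans_le (hh.im_le_invHeight hdisc z)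

theorem invHeight_le_mul_exp {Γ : Subgroup G} (hdisc : DiscreteTopology Γ)
    (z w : UpperHalfPlane) : invHeight Γ z ≤ invHeight Γ w * Real.exp (dist z w) := by
  have h1 := one_le_invHeight Γ w
  have h2 : 1 ≤ Real.exp (dist z w) := Real.one_le_exp dist_nonneg
  refine max_le (one_le_mul_of_one_le_of_one_le h1 h2) (Real.sSup_le ?_ (by positivity))
  rintro t ⟨η, -, h, ⟨-, hh⟩, rfl⟩
  refine (UpperHalfPlane.im_le_im_mul_exp_dist (h • z) (h • w)).trans ?_
  rw [dist_smul]
  gcongr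
  exact hh.im_le_invHeight hdisc w

/-! ### Homomorphisms to `ℤ` from almost invariant functions -/

section OrbitDiff

variable {Δ X : Type*} [Group Δ] [MulAction Δ X]

/-- The sum over `γ` of the increments of `u` from `γ z` to `γ w`. -/
noncomputable def orbitDiff (Δ : Type*) {X : Type*} [Group Δ] [MulAction Δ X] (u : X → ℤ)
    (z w : X) : ℤ :=
  ∑ᶠ γ : Δ, (u (γ • w) - u (γ • z))

theorem orbitDiff_add {u : X → ℤ}
    (hu : ∀ z w : X, (Function.support fun γ : Δ => u (γ • w) - u (γ • z)).Finite) (z w v : X) :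
    orbitDiff Δ u z w + orbitDiff Δ u w v = orbitDiff Δ u z v := by
  rw [orbitDiff, orbitDiff, orbitDiff, ← finsum_add_distrib (hu z w) (hu w v)]
  exact finsum_congr fun γ => by ring

theorem orbitDiff_smul (u : X → ℤ) (g : Δ) (z w : X) :
    orbitDiff Δ u (g • z) (g • w) = orbitDiff Δ u z w := by
  rw [orbitDiff, orbitDiff,
    ← finsum_comp_equiv (Equiv.mulRight g) (f := fun γ : Δ => u (γ • w) - u (γ • z))]
  exact finsum_congr fun γ => by simp [mul_smul]

/-- The two base points differ by a term that cancels by invariance. This allows the homomorphism to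
be evaluated from a point chosen high in a cusp. -/
theorem orbitDiff_self_smul {u : X → ℤ}
    (hu : ∀ z w : X, (Function.support fun γ : Δ => u (γ • w) - u (γ • z)).Finite)
    (g : Δ) (z w : X) : orbitDiff Δ u z (g • z) = orbitDiff Δ u w (g • w) := by
  have h1 := orbitDiff_add hu z w (g • w)
  have h2 := orbitDiff_add hu z (g • z) (g • w)
  rw [orbitDiff_smul] at h2
  linarith

/-- If `u` is almost invariant, then `g ↦ orbitDiff u z (g z)` is a homomorphism. -/
noncomputable def orbitDiffHom (u : X → ℤ)
    (hu : ∀ z w : X, (Function.support fun γ : Δ => u (γ • w) - u (γ • z)).Finite) (z : X) :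
    Additive Δ →+ ℤ :=
  AddMonoidHom.mk' (fun g => orbitDiff Δ u z (g.toMul • z)) (by
    intro g h
    rw [← orbitDiff_add hu z (g.toMul • z), toMul_add, mul_smul, orbitDiff_smul])

end OrbitDiff

/-- A finitely generated group has only finitely many independent homomorphisms to `ℤ`. -/
theorem finite_of_dual_homs {Δ J : Type*} [Group Δ] [hfg : Group.FG Δ] (φ : J → Additive Δ →+ ℤ)
    (t : J → Δ) (hne : ∀ j, φ j (Additive.ofMul (t j)) ≠ 0)
    (h0 : ∀ j m, j ≠ m → φ j (Additive.ofMul (t m)) = 0) : Finite J := by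
  obtain ⟨S, hS⟩ := hfg.out
  -- A relation between the values on generators extends to all of `Δ`; evaluating it at `t m`
  -- isolates the coefficient of `m`. Thus `v` is independent in a finite-dimensional space.
  let v : J → S → ℚ := fun j s => φ j (Additive.ofMul s)
  have hv : LinearIndependent ℚ v := by
    rw [linearIndependent_iff']
    intro s c hc m hm
    have key : ∀ x : Δ, ∑ j ∈ s, c j * (φ j (Additive.ofMul x) : ℚ) = 0 := by
      intro x
      have hx : x ∈ Subgroup.closure (S : Set Δ) := hS ▸ Subgroup.mem_top x
      induction hx using Subgroup.closure_induction with
      | mem x hx =>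
        have := congrFun hc ⟨x, hx⟩
        simpa [v] using this
      | one => simp
      | mul x y _ _ hx hy =>
        simp only [ofMul_mul, map_add, Int.cast_add, mul_add, Finset.sum_add_distrib, hx, hy,
          add_zero]
      | inv x _ hx =>
        simp only [ofMul_inv, map_neg, Int.cast_neg, mul_neg, Finset.sum_neg_distrib, hx, neg_zero]
    have h1 := key (t m)
    rw [Finset.sum_eq_single_of_mem m hm
      (fun j _ hj => by rw [h0 j m hj, Int.cast_zero, mul_zero])] at h1
    exact (mul_eq_zero.1 h1).resolve_right (Int.cast_ne_zero.2 (hne m))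
  exact hv.finite

/-! ### Finiteness of the set of orbits of parabolic fixed points -/

/-- The indicator function of the side `Re (h₀ z) > x` of a geodesic. -/
noncomputable def sideIndicator (h₀ : G) (x : ℝ) (z : UpperHalfPlane) : ℤ :=
  open scoped Classical in if x < (h₀ • z).re then 1 else 0

theorem exists_re_eq_of_sideIndicator_ne {X : Type*} [TopologicalSpace X] [PreconnectedSpace X]
    {h₀ : G} {x : ℝ} {f : X → UpperHalfPlane} (hf : Continuous f) {s t : X}
    (hne : sideIndicator h₀ x (f s) ≠ sideIndicator h₀ x (f t)) :
    ∃ r, (h₀ • f r).re = x := by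
  have hc : Continuous fun r => (h₀ • f r).re :=
    UpperHalfPlane.continuous_re.comp ((isometry_smul UpperHalfPlane h₀).continuous.comp hf)
  unfold sideIndicator at hne
  by_cases h1 : x < (h₀ • f s).re <;> by_cases h2 : x < (h₀ • f t).re
  · simp [h1, h2] at hne
  · exact mem_range_of_exists_le_of_exists_ge hc ⟨t, not_lt.1 h2⟩ ⟨s, h1.le⟩
  · exact mem_range_of_exists_le_of_exists_ge hc ⟨s, not_lt.1 h1⟩ ⟨t, h2.le⟩
  · simp [h1, h2] at hne

theorem abs_log_le_of_mem {a b y : ℝ} (ha : 0 < a) (h1 : a ≤ y) (h2 : y ≤ b) :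
    |Real.log y| ≤ |Real.log a| + |Real.log b| := by
  have h3 := Real.log_le_log ha h1
  have h4 := Real.log_le_log (ha.trans_le h1) h2
  rw [abs_le]
  constructor
  · linarith [neg_abs_le (Real.log a), abs_nonneg (Real.log b)]
  · linarith [le_abs_self (Real.log b), abs_nonneg (Real.log a)]

/-- The points of bounded height on the geodesic joining two boundary points form a bounded
set. -/
theorem exists_dist_le_of_re_eq {h₀ h : G} {x : ℝ}
    (hx : h • h₀⁻¹ • (x : OnePoint ℝ) = OnePoint.infty) :
    ∃ q₀ : UpperHalfPlane, ∀ M : ℝ, ∃ R : ℝ, ∀ q : UpperHalfPlane, (h₀ • q).re = x →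
      (h₀ • q).im ≤ M → (h • q).im ≤ M → dist q q₀ ≤ R := by
  rw [← mul_smul] at hx
  obtain ⟨k, a, hk, hka⟩ := exists_inversion_of_smul_coe hx
  -- On the geodesic the `h`-height is `1 / (k y)`, where `y` is the `h₀`-height. Both being at most
  -- `M` confines `y` to `[1 / (k M), M]`.
  refine ⟨h₀⁻¹ • ⟨⟨x, 1⟩, one_pos⟩, fun M => ⟨|Real.log (1 / (k * M))| + |Real.log M|, ?_⟩⟩
  intro q hq h1 h2
  have hpos := (h₀ • q).im_pos
  have hM : 0 < M := hpos.trans_le h1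
  have h3 := (hka (h₀ • q)).1
  rw [← mul_smul, inv_mul_cancel_right, hq, sub_self] at h3
  have h4 : 1 / (k * M) ≤ (h₀ • q).im := by
    rw [h3, div_le_iff₀ (by positivity)] at h2
    rw [div_le_iff₀ (by positivity)]
    nlinarith
  rw [← dist_smul h₀, smul_inv_smul, UpperHalfPlane.dist_of_re_eq (by rw [hq]; rfl)]
  change dist (Real.log (h₀ • q).im) (Real.log 1) ≤ _
  rw [Real.log_one, dist_zero_right, Real.norm_eq_abs]
  exact abs_log_le_of_mem (by positivity) h4 h1

section

variable {Γ : Subgroup G} {η₀ : OnePoint ℝ} {h₀ h : G} {x : ℝ}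

/-- A half-plane bounded by a geodesic joining two parabolic fixed points is almost invariant. -/
theorem finite_support_sideIndicator (hdisc : DiscreteTopology Γ) (hh₀ : NormalizesStab Γ η₀ h₀)
    (hh : NormalizesStab Γ (h₀⁻¹ • (x : OnePoint ℝ)) h) (z w : UpperHalfPlane) :
    (Function.support fun γ : Γ =>
      sideIndicator h₀ x (γ • w) - sideIndicator h₀ x (γ • z)).Finite := by
  obtain ⟨p⟩ : Nonempty (Path z w) := ⟨PathConnectedSpace.somePath z w⟩
  obtain ⟨R, hR⟩ := (isCompact_range p.continuous).isBounded.subset_closedBall z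
  obtain ⟨q₀, hq₀⟩ := exists_dist_le_of_re_eq hh.smul_eq_infty
  -- This bounds the invariant height on every translate of the path, so any crossing lies on a
  -- bounded piece of the geodesic, and proper discontinuity applies.
  obtain ⟨R', hR'⟩ := hq₀ (invHeight Γ z * Real.exp R)
  refine Set.Finite.of_finite_image (f := Subtype.val)
    ((finite_dist_le hdisc z q₀ (R + R')).subset ?_) Subtype.val_injective.injOn
  rintro _ ⟨γ, hγ, rfl⟩
  refine ⟨γ.2, ?_⟩
  have hne : sideIndicator h₀ x (γ.1 • p 1) ≠ sideIndicator h₀ x (γ.1 • p 0) := by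
    rw [p.source, p.target]
    exact sub_ne_zero.1 hγ
  obtain ⟨r, hr⟩ := exists_re_eq_of_sideIndicator_ne
    ((isometry_smul UpperHalfPlane γ.1).continuous.comp p.continuous) hne
  have hd : dist (p r) z ≤ R := hR ⟨r, rfl⟩
  have hY : invHeight Γ (γ.1 • p r) ≤ invHeight Γ z * Real.exp R := by
    rw [invHeight_smul γ.2]
    refine (invHeight_le_mul_exp hdisc _ z).trans ?_
    have := one_le_invHeight Γ z
    gcongr
  have h1 := hR' (γ.1 • p r) hr ((hh₀.im_le_invHeight hdisc _).trans hY)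
    ((hh.im_le_invHeight hdisc _).trans hY)
  have h2 := dist_triangle (γ.1 • z) (γ.1 • p r) q₀
  rw [dist_smul, dist_comm z] at h2
  linarith

theorem continuous_unip_smul (z : UpperHalfPlane) : Continuous fun r : ℝ => unip r • z := by
  rw [UpperHalfPlane.isOpenEmbedding_coe.isEmbedding.continuous_iff]
  have : (UpperHalfPlane.coe ∘ fun r : ℝ => unip r • z) = fun r : ℝ => (z : ℂ) + r := by
    funext r
    apply Complex.ext
    · simpa using unip_smul_re r z
    · simpa using unip_smul_im r z
  rw [this]
  fun_prop

/-- High horocycles based away from the end points of a geodesic do not cross it. -/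
theorem exists_sideIndicator_eq (hdisc : DiscreteTopology Γ) (hh₀ : NormalizesStab Γ η₀ h₀)
    (hh : NormalizesStab Γ (h₀⁻¹ • (x : OnePoint ℝ)) h) :
    ∃ M : ℝ, ∀ (η : OnePoint ℝ) (g : G), NormalizesStab Γ η g → η ≠ η₀ →
      η ≠ h₀⁻¹ • (x : OnePoint ℝ) → ∀ z : UpperHalfPlane, M < (g • z).im → ∀ r : ℝ,
      sideIndicator h₀ x ((g⁻¹ * unip r * g) • z) = sideIndicator h₀ x z := by
  obtain ⟨q₀, hq₀⟩ := exists_dist_le_of_re_eq hh.smul_eq_infty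
  obtain ⟨R, hR⟩ := hq₀ 1
  -- Above height 1, a crossing point is low at both ends of the geodesic, hence within `R` of `q₀`.
  -- Its height is then at most the second term.
  refine ⟨max 1 (invHeight Γ q₀ * Real.exp R), ?_⟩
  intro η g hg hne₀ hne z hz r
  by_contra hcon
  have hf : Continuous fun s : ℝ => g⁻¹ • unip s • g • z :=
    (isometry_smul UpperHalfPlane g⁻¹).continuous.comp (continuous_unip_smul _)
  have hcon' : sideIndicator h₀ x (g⁻¹ • unip r • g • z) ≠
      sideIndicator h₀ x (g⁻¹ • unip 0 • g • z) := by
    rwa [unip_zero, one_smul, inv_smul_smul, ← mul_smul, ← mul_smul]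
  obtain ⟨s, hs⟩ := exists_re_eq_of_sideIndicator_ne hf hcon'
  set q := g⁻¹ • unip s • g • z
  have hq : (g • q).im = (g • z).im := by
    rw [smul_inv_smul, unip_smul_im]
  rw [← hq, max_lt_iff] at hz
  have hd := hR q hs (hg.im_lt_one hdisc hh₀ hne₀ hz.1).le (hg.im_lt_one hdisc hh hne hz.1).le
  have h1 := (hg.im_le_invHeight hdisc q).trans (invHeight_le_mul_exp hdisc q q₀)
  have h2 : invHeight Γ q₀ * Real.exp (dist q q₀) ≤ invHeight Γ q₀ * Real.exp R := by
    have := one_le_invHeight Γ q₀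
    gcongr
  linarith [hz.2]

theorem exists_re_im_smul (g : G) (a b : ℝ) (hb : 0 < b) :
    ∃ z : UpperHalfPlane, (g • z).re = a ∧ (g • z).im = b :=
  ⟨g⁻¹ • ⟨⟨a, b⟩, hb⟩, by rw [smul_inv_smul]; rfl, by rw [smul_inv_smul]; rfl⟩

/-- With the base point high in the cusp at `η`, `w` and `t w` lie on one horocycle. None of its
translates crosses the geodesic, so every summand vanishes. -/
theorem orbitDiff_sideIndicator_eq_zero (hdisc : DiscreteTopology Γ)
    (hh₀ : NormalizesStab Γ η₀ h₀) (hh : NormalizesStab Γ (h₀⁻¹ • (x : OnePoint ℝ)) h)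
    {η : OnePoint ℝ} {g : G} (hg : NormalizesStab Γ η g) (hne₀ : ∀ γ ∈ Γ, γ • η ≠ η₀)
    (hne : ∀ γ ∈ Γ, γ • η ≠ h₀⁻¹ • (x : OnePoint ℝ)) {t : Γ} (ht : t.1 = g⁻¹ * unip 1 * g)
    (z : UpperHalfPlane) : orbitDiff Γ (sideIndicator h₀ x) z (t • z) = 0 := by
  obtain ⟨M, hM⟩ := exists_sideIndicator_eq hdisc hh₀ hh
  obtain ⟨w, -, hw⟩ := exists_re_im_smul g 0 (max 1 (M + 1)) (by positivity)
  rw [orbitDiff_self_smul (finite_support_sideIndicator hdisc hh₀ hh) t z w, orbitDiff]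
  refine finsum_eq_zero_of_forall_eq_zero fun γ => ?_
  rw [sub_eq_zero]
  have h1 := hM (γ.1 • η) (g * γ.1⁻¹) (hg.translate γ.2) (hne₀ _ γ.2) (hne _ γ.2) (γ.1 • w)
    (by
      rw [← mul_smul, inv_mul_cancel_right, hw]
      exact lt_max_of_lt_right (lt_add_one M)) 1
  rw [← mul_smul] at h1
  change sideIndicator h₀ x (γ.1 • t.1 • w) = sideIndicator h₀ x (γ.1 • w)
  rw [← h1, ht, ← mul_smul]
  congr 2
  group

/-- Translates of a high horocycle segment to other pfps do not cross the geodesic. Those by the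
stabilizer are consecutive unit segments in the coordinate `h`, exactly one of which crosses it. -/
theorem orbitDiff_sideIndicator_eq_neg_one (hdisc : DiscreteTopology Γ)
    (hh₀ : NormalizesStab Γ η₀ h₀) (hh : NormalizesStab Γ (h₀⁻¹ • (x : OnePoint ℝ)) h)
    (hne₀ : ∀ γ ∈ Γ, γ • h₀⁻¹ • (x : OnePoint ℝ) ≠ η₀) {t : Γ} (ht : t.1 = h⁻¹ * unip 1 * h)
    (z : UpperHalfPlane) : orbitDiff Γ (sideIndicator h₀ x) z (t • z) = -1 := by
  obtain ⟨M, hM⟩ := exists_sideIndicator_eq hdisc hh₀ hh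
  have hx := hh.smul_eq_infty
  rw [← mul_smul] at hx
  obtain ⟨k, a, hk, hka⟩ := exists_inversion_of_smul_coe hx
  have hside : ∀ q : UpperHalfPlane, x < (h₀ • q).re ↔ (h • q).re < a := by
    intro q
    have h1 := (hka (h₀ • q)).2
    rw [← mul_smul, inv_mul_cancel_right] at h1
    have hp := (h₀ • q).im_pos
    rw [h1, sub_lt_self_iff, div_pos_iff_of_pos_right (by positivity), sub_pos]
  -- In the coordinate `h` the geodesic is the line `Re = a`. The offset `1 / 2` keeps the end
  -- points `a - 1/2 + n` and `a + 1/2 + n` off this line, so only `n = 0` contributes.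
  obtain ⟨w, hwre, hw⟩ := exists_re_im_smul h (a - 1 / 2) (max 1 (M + 1)) (by positivity)
  rw [orbitDiff_self_smul (finite_support_sideIndicator hdisc hh₀ hh) t z w, orbitDiff]
  have hval : ∀ (γ : Γ) (n : ℤ), h * γ.1 * h⁻¹ = unip n →
      sideIndicator h₀ x (γ.1 • t.1 • w) - sideIndicator h₀ x (γ.1 • w) =
      if n = 0 then -1 else 0 := by
    intro γ n hn
    have e1 : (h • γ.1 • w).re = a - 1 / 2 + n := by
      rw [← hwre, ← unip_smul_re, ← hn]
      simp only [← mul_smul]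
      congr 2
      group
    have e2 : (h • γ.1 • t.1 • w).re = a - 1 / 2 + n + 1 := by
      rw [← hwre, ht, ← unip_smul_re, ← unip_smul_re, ← mul_smul (unip 1), ← unip_add,
        add_comm, unip_add, ← hn]
      simp only [← mul_smul]
      congr 2
      group
    simp only [sideIndicator, hside, e1, e2]
    rcases lt_trichotomy n 0 with h1 | h1 | h1
    · have h2 : (n : ℝ) ≤ -1 := by exact_mod_cast Int.le_sub_one_of_lt h1
      rw [if_pos (by linarith), if_pos (by linarith), if_neg h1.ne, sub_self]
    · subst h1
      rw [if_neg (by push_cast; linarith), if_pos (by push_cast; linarith), if_pos rfl, zero_sub]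
    · have h2 : (1 : ℝ) ≤ n := by exact_mod_cast h1
      rw [if_neg (by linarith), if_neg (by linarith), if_neg h1.ne', sub_self]
  rw [finsum_eq_single _ (1 : Γ)]
  · have h1 := hval 1 0 (by rw [OneMemClass.coe_one, Int.cast_zero, unip_zero]; group)
    rw [if_pos rfl] at h1
    exact h1
  · intro γ hγ
    by_cases hst : γ.1 • h₀⁻¹ • (x : OnePoint ℝ) = h₀⁻¹ • (x : OnePoint ℝ)
    · obtain ⟨n, hn⟩ := hh.exists_unip γ.2 hst
      have h1 := hval γ n hn
      rw [if_neg] at h1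
      · exact h1
      · rintro rfl
        apply hγ
        rw [Int.cast_zero, unip_zero, conj_eq_one_iff] at hn
        exact Subtype.ext hn
    · rw [sub_eq_zero]
      have h1 := hM _ (h * γ.1⁻¹) (hh.translate γ.2) (hne₀ _ γ.2) hst (γ.1 • w)
        (by
          rw [← mul_smul, inv_mul_cancel_right, hw]
          exact lt_max_of_lt_right (lt_add_one M)) 1
      rw [← mul_smul] at h1
      change sideIndicator h₀ x (γ.1 • t.1 • w) = sideIndicator h₀ x (γ.1 • w)
      rw [← h1, ht, ← mul_smul]
      congr 2
      group

end

/-- A finitely generated discrete subgroup has finitely many orbits of parabolic fixed points. -/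
theorem exists_finite_pfp_representatives {Γ : Subgroup G} (hfg : Γ.FG)
    (hdisc : DiscreteTopology Γ) :
    ∃ F : Set (OnePoint ℝ), F.Finite ∧ (∀ η ∈ F, IsPfp Γ η) ∧
      ∀ η, IsPfp Γ η → ∃ γ ∈ Γ, γ • η ∈ F := by
  by_cases H : ∃ η₀ h₀, NormalizesStab Γ η₀ h₀
  swap
  · exact ⟨∅, Set.finite_empty, by simp, fun η ⟨h, hh⟩ => (H ⟨η, h, hh⟩).elim⟩
  obtain ⟨η₀, h₀, hh₀⟩ := H
  have : Group.FG Γ := (Group.fg_iff_subgroup_fg Γ).2 hfg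
  -- The orbit of `η₀` is excluded because `η₀` is the common starting point of all the geodesics.
  let J := {o : MulAction.orbitRel.Quotient Γ (OnePoint ℝ) //
    IsPfp Γ o.out ∧ o ≠ Quotient.mk _ η₀}
  have hout : ∀ (o : MulAction.orbitRel.Quotient Γ (OnePoint ℝ)) (η : OnePoint ℝ),
      (∃ γ ∈ Γ, γ • o.out = η) → o = Quotient.mk _ η := by
    rintro o η ⟨γ, hγ, rfl⟩
    rw [← Quotient.out_eq o]
    refine Quotient.sound ?_
    change (Quotient.out o) ∈ MulAction.orbit Γ (γ • _)
    rw [Quotient.out_eq o]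
    exact ⟨⟨γ⁻¹, Γ.inv_mem hγ⟩, inv_smul_smul γ _⟩
  have hne₀ : ∀ j : J, ∀ γ ∈ Γ, γ • j.1.out ≠ η₀ := fun j γ hγ he =>
    j.2.2 (hout _ _ ⟨γ, hγ, he⟩)
  have hne : ∀ j m : J, j ≠ m → ∀ γ ∈ Γ, γ • m.1.out ≠ j.1.out := by
    intro j m hjm γ hγ he
    refine hjm (Subtype.ext ?_)
    rw [hout m.1 _ ⟨γ, hγ, he⟩, Quotient.out_eq]
  choose h hh using fun j : J => j.2.1
  have hx : ∀ j : J, ∃ x : ℝ, h₀⁻¹ • (x : OnePoint ℝ) = j.1.out := by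
    intro j
    have h1 : h₀ • j.1.out ≠ OnePoint.infty := by
      intro he
      rw [← hh₀.smul_eq_infty] at he
      exact hne₀ j 1 Γ.one_mem (by rw [one_smul]; exact MulAction.injective h₀ he)
    obtain ⟨x, hx⟩ := OnePoint.ne_infty_iff_exists.1 h1
    exact ⟨x, by rw [hx, inv_smul_smul]⟩
  choose x hx using hx
  have hh' : ∀ j, NormalizesStab Γ (h₀⁻¹ • (x j : OnePoint ℝ)) (h j) := fun j => by
    rw [hx]; exact hh j
  have hmem : ∀ j, (h j)⁻¹ * unip 1 * h j ∈ Γ := fun j => by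
    simpa using (hh j).conj_unip_mem 1
  let φ : J → Additive Γ →+ ℤ := fun j =>
    orbitDiffHom (sideIndicator h₀ (x j)) (finite_support_sideIndicator hdisc hh₀ (hh' j))
      UpperHalfPlane.I
  have hJ : Finite J := by
    refine finite_of_dual_homs φ (fun j => ⟨_, hmem j⟩) (fun j => ?_) fun j m hjm => ?_
    · have := orbitDiff_sideIndicator_eq_neg_one hdisc hh₀ (hh' j)
        (by rw [hx]; exact hne₀ j) (t := ⟨_, hmem j⟩) rfl UpperHalfPlane.I
      intro h0
      exact absurd (this.symm.trans h0) (by norm_num)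
    · exact orbitDiff_sideIndicator_eq_zero hdisc hh₀ (hh' j) (hh m) (hne₀ m)
        (by rw [hx]; exact hne j m hjm) (t := ⟨_, hmem m⟩) rfl UpperHalfPlane.I
  refine ⟨insert η₀ (Set.range fun j : J => j.1.out), (Set.finite_range _).insert _, ?_, ?_⟩
  · rintro η (rfl | ⟨j, rfl⟩)
    · exact ⟨h₀, hh₀⟩
    · exact j.2.1
  · rintro η ⟨g, hg⟩
    have hex : ∃ γ ∈ Γ, γ • η = (Quotient.mk (MulAction.orbitRel Γ (OnePoint ℝ)) η).out := by
      obtain ⟨γ, hγ⟩ : (Quotient.mk (MulAction.orbitRel Γ (OnePoint ℝ)) η).out ∈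
          MulAction.orbit Γ η :=
        Quotient.mk_out (s := MulAction.orbitRel Γ (OnePoint ℝ)) η
      exact ⟨γ.1, γ.2, hγ⟩
    obtain ⟨γ, hγ, he⟩ := hex
    by_cases ho : (Quotient.mk (MulAction.orbitRel Γ (OnePoint ℝ)) η) = Quotient.mk _ η₀
    · obtain ⟨δ, hδ⟩ : η₀ ∈ MulAction.orbit Γ η := Quotient.exact ho.symm
      exact ⟨δ.1, δ.2, Or.inl hδ⟩
    · refine ⟨γ, hγ, Or.inr ⟨⟨Quotient.mk _ η, ?_, ho⟩, he.symm⟩⟩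
      rw [← he]
      exact ⟨_, hg.translate hγ⟩

/-! ### Comparison of the height with the distance -/

theorem dist_I_le_of_re_le {w : UpperHalfPlane} (hre : |w.re| ≤ 1) (him : 1 < w.im) :
    dist w UpperHalfPlane.I ≤ Real.log w.im + 1 := by
  have hpos : 0 < w.im := w.im_pos
  let v : UpperHalfPlane := ⟨⟨0, w.im⟩, hpos⟩
  have h1 : dist w v ≤ 1 := by
    refine (UpperHalfPlane.dist_le_dist_coe_div_sqrt w v).trans ?_
    have hv : v.im = w.im := rfl
    rw [hv, Real.sqrt_mul_self hpos.le, div_le_one hpos, Complex.dist_of_im_eq (by rfl)]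
    change dist w.re 0 ≤ _
    rw [dist_zero_right, Real.norm_eq_abs]
    linarith
  have h2 : dist v UpperHalfPlane.I = Real.log w.im := by
    rw [UpperHalfPlane.dist_of_re_eq (by rfl), UpperHalfPlane.I_im, Real.log_one, dist_zero_right,
      Real.norm_eq_abs]
    exact abs_of_pos (Real.log_pos him)
  linarith [dist_triangle w v UpperHalfPlane.I]

theorem NormalizesStab.exists_dist_le {Γ : Subgroup G} {η : OnePoint ℝ} {h : G}
    (hh : NormalizesStab Γ η h) {z : UpperHalfPlane} (hz : 1 < (h • z).im) :
    ∃ γ ∈ Γ, dist (γ • z) UpperHalfPlane.I ≤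
      Real.log (h • z).im + 1 + dist (h⁻¹ • UpperHalfPlane.I) UpperHalfPlane.I := by
  -- This integer translation brings the real part of `h • z` into `[-1/2, 1/2]` without changing
  -- its height.
  refine ⟨_, hh.conj_unip_mem (-round (h • z).re), ?_⟩
  refine (dist_triangle _ (h⁻¹ • UpperHalfPlane.I) _).trans ?_
  gcongr
  rw [mul_smul, mul_smul, dist_smul]
  have := dist_I_le_of_re_le (w := unip ((-round (h • z).re : ℤ) : ℝ) • h • z) ?_
    (by rwa [unip_smul_im])
  · rwa [unip_smul_im] at this
  · rw [unip_smul_re, Int.cast_neg, ← sub_eq_add_neg]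
    exact (abs_sub_round _).trans (by norm_num)

/-- The error in `NormalizesStab.exists_dist_le` depends on the normalizer. Moving the pfp to one of
finitely many representatives, each with a fixed normalizer, makes it uniform. -/
theorem exists_dist_le_log_invHeight {Γ : Subgroup G} (hfg : Γ.FG) (hdisc : DiscreteTopology Γ) :
    ∃ C : ℝ, ∀ z : UpperHalfPlane, 1 < invHeight Γ z →
      ∃ γ ∈ Γ, dist (γ • z) UpperHalfPlane.I ≤ Real.log (invHeight Γ z) + C := by
  obtain ⟨F, hF, hpfp, hrep⟩ := exists_finite_pfp_representatives hfg hdisc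
  choose! g hg using hpfp
  obtain ⟨C, hC⟩ := (hF.image fun η =>
    dist ((g η)⁻¹ • UpperHalfPlane.I) UpperHalfPlane.I).bddAbove
  refine ⟨1 + C, fun z hz => ?_⟩
  obtain ⟨η, h, hh, hhz⟩ := (one_lt_invHeight_iff hdisc).1 hz
  obtain ⟨γ, hγ, hmem⟩ := hrep η ⟨h, hh⟩
  have him : (g (γ • η) • γ • z).im = (h • z).im := by
    rw [(hg _ hmem).im_eq (hh.translate hγ), mul_smul, inv_smul_smul]
  obtain ⟨δ, hδ, hd⟩ := (hg _ hmem).exists_dist_le (z := γ • z) (by rwa [him])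
  refine ⟨δ * γ, Γ.mul_mem hδ hγ, ?_⟩
  rw [mul_smul]
  have h1 : Real.log (h • z).im ≤ Real.log (invHeight Γ z) :=
    Real.log_le_log (h • z).im_pos (hh.im_le_invHeight hdisc z)
  have h2 := hC ⟨_, hmem, rfl⟩
  rw [him] at hd
  linarith

theorem exists_horoballs {Γ : Subgroup G} (hdisc : DiscreteTopology Γ) :
    ∃ σ : OnePoint ℝ → ℝ, (∀ η, IsPfp Γ η → 0 < σ η) ∧
      {z | 1 < invHeight Γ z} = ⋃ η ∈ {η | IsPfp Γ η}, horoball η (σ η) ∧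
      {η | IsPfp Γ η}.PairwiseDisjoint (fun η => horoball η (σ η)) := by
  have hex : ∀ η, IsPfp Γ η → ∃ σ : ℝ, 0 < σ ∧
      ∀ h, NormalizesStab Γ η h → horoball η σ = {z | 1 < (h • z).im} := by
    rintro η ⟨h, hh⟩
    obtain ⟨σ, hσ, he⟩ := exists_horoball_eq hh.smul_eq_infty
    refine ⟨σ, hσ, fun h' hh' => ?_⟩
    rw [he]
    ext z
    rw [Set.mem_ofPred_eq, Set.mem_ofPred_eq, hh.im_eq hh']
  choose! σ hσ he using hex
  refine ⟨σ, hσ, ?_, ?_⟩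
  · ext z
    rw [Set.mem_ofPred_eq, one_lt_invHeight_iff hdisc, Set.mem_iUnion₂]
    constructor
    · rintro ⟨η, h, hh, hz⟩
      refine ⟨η, ⟨h, hh⟩, ?_⟩
      rw [he η ⟨h, hh⟩ h hh]
      exact hz
    · rintro ⟨η, ⟨h, hh⟩, hz⟩
      rw [he η ⟨h, hh⟩ h hh] at hz
      exact ⟨η, h, hh, hz⟩
  · rintro η ⟨h, hh⟩ η' ⟨h', hh'⟩ hne
    refine Set.disjoint_left.2 fun z hz hz' => ?_
    change z ∈ horoball η (σ η) at hz
    change z ∈ horoball η' (σ η') at hz'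
    rw [he η ⟨h, hh⟩ h hh] at hz
    rw [he η' ⟨h', hh'⟩ h' hh'] at hz'
    exact lt_asymm hz' (hh.im_lt_one hdisc hh' hne hz)

end HypSurf

/-- For a finitely generated torsion-free discrete subgroup `Γ` of `PSL(2, ℝ)`: the supremum
defining the height function is finite, the set where the height exceeds `1` is a `Γ`-invariant
disjoint union of horoballs based at the parabolic fixed points, and there the height is
comparable to the exponential of the distance to `Γ e`. -/
theorem proposition2p1 (Γ : Subgroup G) (hfg : Γ.FG) (hdisc : DiscreteTopology Γ)
    (htf : ∀ γ ∈ Γ, IsOfFinOrder γ → γ = 1) :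
    (∀ z : UpperHalfPlane, BddAbove (cuspHeights Γ z)) ∧
    (∀ γ ∈ Γ, (fun z : UpperHalfPlane => γ • z) '' {z | 1 < invHeight Γ z} =
      {z | 1 < invHeight Γ z}) ∧
    (∃ σ : OnePoint ℝ → ℝ, (∀ η, IsPfp Γ η → 0 < σ η) ∧
      {z | 1 < invHeight Γ z} = ⋃ η ∈ {η | IsPfp Γ η}, horoball η (σ η) ∧
      {η | IsPfp Γ η}.PairwiseDisjoint (fun η => horoball η (σ η))) ∧
    (∃ c₀ c₁ : ℝ, 0 < c₀ ∧ c₀ < c₁ ∧ ∀ x : CosetSpace Γ, 1 < cosetHeight Γ x →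
      c₀ * Real.exp (cosetDist Γ x (coset Γ 1)) ≤ cosetHeight Γ x ∧
      cosetHeight Γ x ≤ c₁ * Real.exp (cosetDist Γ x (coset Γ 1))) := by
  refine ⟨bddAbove_cuspHeights hdisc, ?_, exists_horoballs hdisc, ?_⟩
  · intro γ hγ
    ext z
    constructor
    · rintro ⟨w, hw, rfl⟩
      change 1 < invHeight Γ (γ • w)
      rwa [invHeight_smul hγ]
    · intro hz
      refine ⟨γ⁻¹ • z, ?_, smul_inv_smul γ z⟩
      change 1 < invHeight Γ (γ⁻¹ • z)
      rwa [invHeight_smul (Γ.inv_mem hγ)]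
  · obtain ⟨C, hC⟩ := exists_dist_le_log_invHeight hfg hdisc
    -- The height at `i` already suffices as upper constant; adding `exp (-C)` ensures `c₀ < c₁`.
    refine ⟨Real.exp (-C), Real.exp (-C) + invHeight Γ UpperHalfPlane.I, Real.exp_pos _,
      lt_add_of_pos_right _ (one_pos.trans_le (one_le_invHeight _ _)), fun x hx => ?_⟩
    induction x using Quotient.inductionOn with
    | h g =>
      change 1 < invHeight Γ (g • UpperHalfPlane.I) at hx
      change _ ≤ invHeight Γ (g • UpperHalfPlane.I) ∧ invHeight Γ (g • UpperHalfPlane.I) ≤ _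
      have hd : cosetDist Γ (Quotient.mk _ g) (coset Γ 1) =
          ⨅ γ : Γ, dist ((γ : G) • g • UpperHalfPlane.I) UpperHalfPlane.I := by
        change (⨅ γ : Γ, dist ((γ : G) • g • UpperHalfPlane.I) ((1 : G) • UpperHalfPlane.I)) = _
        rw [one_smul]
      rw [hd]
      set z := g • UpperHalfPlane.I
      have hpos : 0 < invHeight Γ z := one_pos.trans hx
      have hI := one_le_invHeight Γ UpperHalfPlane.I
      constructor
      · obtain ⟨γ, hγ, hle⟩ := hC z hx
        have h1 : (⨅ γ : Γ, dist ((γ : G) • z) UpperHalfPlane.I) ≤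
            Real.log (invHeight Γ z) + C :=
          (ciInf_le ⟨0, by rintro _ ⟨γ, rfl⟩; exact dist_nonneg⟩ (⟨γ, hγ⟩ : Γ)).trans hle
        rw [← Real.exp_add, ← Real.le_log_iff_exp_le hpos]
        linarith
      · have h1 : Real.log (invHeight Γ z / invHeight Γ UpperHalfPlane.I) ≤
            ⨅ γ : Γ, dist ((γ : G) • z) UpperHalfPlane.I := by
          refine le_ciInf fun γ => ?_
          rw [Real.log_le_iff_le_exp (by positivity), div_le_iff₀' (by positivity),
            ← invHeight_smul γ.2]
          exact invHeight_le_mul_exp hdisc _ _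
        rw [Real.log_le_iff_le_exp (by positivity), div_le_iff₀' (by positivity)] at h1
        refine h1.trans ?_
        gcongr
        exact le_add_of_nonneg_left (Real.exp_pos _).le
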